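/- Consider the linear system $\dot x = Ax+bu$ with $A\in\mathbb R^{n\times n}$, $b\in\mathbb R^n$ and $\operatorname{rank}[b,Ab,\dots,A^{n-1}b]=n$, with state constraints $c_p^\top x+d_p\le 0$ ($p=1,\dots,P$, $c_p\neq 0$), control constraint $|u|\le u_{\mathrm m}$ ($u_{\mathrm m}>0$), fixed end points $x(0)=x_0$, $x(t_{\mathrm f})=x_{\mathrm f}$, and free terminal time $t_{\mathrm f}$. A pair $(x,u)$ on $[0,t_{\mathrm f}]$ is feasible if it satisfies all of these on $[0,t_{\mathrm f}]$. An arc of a bang-bang/singular trajectory is either unconstrained, with $u\equiv u_{\mathrm m}$ or $u\equiv -u_{\mathrm m}$ and no state constraint identically active, or constrained, with $\mathcal P\neq\varnothing$ the set of all state constraints that are identically active on it. In the latter case $u=\hat a_p^\top x$ with $p=\min\mathcal P$ and $\hat a_p^\top=-c_p^\top A^{r_p}/(c_p^\top A^{r_p-1}b)$, where $r_p\ge 1$ is least with $c_p^\top A^{r_p-1}b\ne 0$. On every arc $\dot x=\hat A x+\hat b$ with constant $\hat A,\hat b$, and each state or control constraint has the form $g(x)=\gamma^\top x+\delta\le 0$,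 with time derivatives $g^{(0)}=g$ and $g^{(r)}=\gamma^\top\hat A^{r-1}(\hat Ax+\hat b)$ for $r\ge1$. Let $(x,u)$ be feasible with finitely many arcs (no chattering). Its keypoints $0=t_0<t_1<\dots<t_M=t_{\mathrm f}$ are the ends of its arcs and the times inside an arc at which some constraint that is not identically active on that arc becomes active. Its augmented switching law $\mathcal L$ consists of the following data, without the times: 1. the sequence of arcs: for each arc the value of $u$, or the set $\mathcal P$ with the equalities $c_p^\top x+d_p=0$ and $c_q^\top(A+b\hat a_p^\top)^rx=0$ ($p,q\in\mathcal P$, $1\le r\le n$); 2. for each keypoint inside an arc, the nonempty set of constraints touched there but not identically active on the arc, each with its even order $k>0$, that is, $g^{(r)}=0$ for $r<k$ and $g^{(k)}<0$; 3. for each connection of two arcs, each constraint and each of the two arcs, the order $k\ge 0$ such that $g^{(r)}=0$ for $r<k$ and $g^{(k)}<0$ on the side of the following arc, respectively $(-1)^kg^{(k)}<0$ on the side of the preceding arc; or, if the constraint is identically active on that arc, the equalities $g^{(r)}=0$ for $0\le r\le n$. A trajectory $(x',u')$ is represented by $\mathcal L$ with keypoint times $0=t'_0<t'_1<\dots<t'_M$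 if $x'(0)=x_0$, $x'(t'_M)=x_{\mathrm f}$, $x'$ is continuous, on each $[t'_{i-1},t'_i]$ it follows the dynamics, control law and equalities prescribed by $\mathcal L$ (at keypoints $u'$ takes a one-sided value), and at each interior $t'_i$ the state $x'(t'_i)$ satisfies the equalities and strict inequalities prescribed by $\mathcal L$. The inequality constraints are not otherwise imposed on $(x',u')$. **Theorem.** Let $(x,u)$ be a feasible non-chattering bang-bang/singular trajectory with augmented switching law $\mathcal L$ and keypoint times $t=(t_i)_{i=1}^M$. Then there is $\varepsilon>0$, depending on $(x,u)$, such that every trajectory $(x',u')$ represented by the same law $\mathcal L$ with keypoint times $t'=(t'_i)_{i=1}^M$ satisfying $\|t'-t\|_\infty<\varepsilon$ is feasible on $[0,t'_M]$; that is, it satisfies the state equation, the end conditions, all state constraints and the control constraint. -/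

import Mathlib

open Set Matrix MeasureTheory

noncomputable section

namespace BBS

/-- Data of the time-optimal problem for a single-input linear system with `n` states and
`P` state constraints:
`x' = A x + b u`, `C x + d ≤ 0`, `|u| ≤ um`, `x 0 = x0`, `x tf = xf`, with `tf` free. -/
structure Problem (n P : ℕ) where
  A : Matrix (Fin n) (Fin n) ℝ
  b : Fin n → ℝ
  C : Matrix (Fin P) (Fin n) ℝ
  d : Fin P → ℝ
  x0 : Fin n → ℝ
  xf : Fin n → ℝ
  um : ℝ
  um_pos : 0 < um
  row_ne_zero : ∀ p, C p ≠ 0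
  /-- the Kalman matrix `[b, A b, …, A ^ (n - 1) b]` has rank `n` -/
  controllable : (Matrix.of fun (i j : Fin n) => ((A ^ (j : ℕ)) *ᵥ b) i).rank = n

variable {n P K : ℕ}

/-- `(x, u)` on `[0, tf]` is feasible: the state equation holds (in the sense of Carathéodory),
together with the boundary conditions, the state constraints and the control constraint. -/
structure Feasible (S : Problem n P) (x : ℝ → Fin n → ℝ) (u : ℝ → ℝ) (tf : ℝ) : Prop where
  time_nonneg : 0 ≤ tf
  continuousOn : ContinuousOn x (Icc 0 tf)
  control_integrable : IntervalIntegrable u volume 0 tf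
  dynamics : ∀ t ∈ Icc 0 tf, x t = x 0 + ∫ s in (0 : ℝ)..t, (S.A *ᵥ x s + u s • S.b)
  initial : x 0 = S.x0
  terminal : x tf = S.xf
  state_constraint : ∀ t ∈ Icc 0 tf, ∀ p, S.C p ⬝ᵥ x t + S.d p ≤ 0
  control_constraint : ∀ t ∈ Icc 0 tf, |u t| ≤ S.um

/-- The order of the state constraint `p`: the least `r ≥ 1` with `c_pᵀ A ^ (r - 1) b ≠ 0`.
(The set is nonempty by controllability, since `c_p ≠ 0`.) -/
def Problem.order (S : Problem n P) (p : Fin P) : ℕ :=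
  sInf {r : ℕ | 1 ≤ r ∧ S.C p ⬝ᵥ ((S.A ^ (r - 1)) *ᵥ S.b) ≠ 0}

/-- The feedback gain `â_p` that keeps constraint `p` active:
`â_pᵀ = - c_pᵀ A ^ r_p / (c_pᵀ A ^ (r_p - 1) b)`. -/
def Problem.gain (S : Problem n P) (p : Fin P) : Fin n → ℝ :=
  -(S.C p ⬝ᵥ ((S.A ^ (S.order p - 1)) *ᵥ S.b))⁻¹ • (S.C p ᵥ* (S.A ^ S.order p))

/-- The closed-loop matrix `A + b â_pᵀ`. -/
def Problem.closedLoop (S : Problem n P) (p : Fin P) : Matrix (Fin n) (Fin n) ℝ :=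
  S.A + Matrix.vecMulVec S.b (S.gain p)

/-- A system behavior of a bang-bang and singular trajectory: either an unconstrained arc
with `u ≡ um` (`true`) or `u ≡ -um` (`false`), or a constrained arc along which exactly the state
constraints in the nonempty set `Q` are identically active. -/
inductive Behavior (P : ℕ) where
  | unconstrained (positive : Bool)
  | constrained (Q : Finset (Fin P)) (hQ : Q.Nonempty)

/-- The set of state constraints that are active along the arc. -/
def Behavior.active : Behavior P → Finset (Fin P)
  | .unconstrained _ => ∅
  | .constrained Q _ => Q

/-- The linear part `κ` of the control law `u = κᵀ x + μ` of an arc. -/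
def Behavior.gain (S : Problem n P) : Behavior P → Fin n → ℝ
  | .unconstrained _ => 0
  | .constrained Q hQ => S.gain (Q.min' hQ)

/-- The constant part `μ` of the control law `u = κᵀ x + μ` of an arc. -/
def Behavior.bias (S : Problem n P) : Behavior P → ℝ
  | .unconstrained positive => if positive then S.um else -S.um
  | .constrained _ _ => 0

/-- The control prescribed by a behavior at the state `x`. -/
def Behavior.control (S : Problem n P) (β : Behavior P) (x : Fin n → ℝ) : ℝ :=
  β.gain S ⬝ᵥ x + β.bias S

/-- The matrix of the dynamics along an arc: `A` if unconstrained, and `A + b â_pᵀ` with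
`p` the least active index if constrained. -/
def Behavior.mat (S : Problem n P) : Behavior P → Matrix (Fin n) (Fin n) ℝ
  | .unconstrained _ => S.A
  | .constrained Q hQ => S.closedLoop (Q.min' hQ)

/-- The constant term of the dynamics along an arc: `± um b` if unconstrained, else `0`. -/
def Behavior.vec (S : Problem n P) (β : Behavior P) : Fin n → ℝ :=
  β.bias S • S.b

/-- The equality constraints carried by an arc; for an unconstrained arc there are none. -/
def Behavior.Equalities (S : Problem n P) (β : Behavior P) (x : Fin n → ℝ) : Prop :=
  (∀ p ∈ β.active, S.C p ⬝ᵥ x + S.d p = 0) ∧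
  ∀ p ∈ β.active, ∀ q ∈ β.active, ∀ r ∈ Finset.Icc 1 n,
    S.C q ⬝ᵥ ((S.closedLoop p ^ r) *ᵥ x) = 0

/-- The inequality constraints: the `P` state constraints, `u ≤ um`, and `-u ≤ um`. -/
inductive Constr (P : ℕ) where
  | state (p : Fin P)
  | upper
  | lower

/-- The coefficients of a constraint, written as `γᵀ x + δ ≤ 0` in the state by means of the
control law of the arc. -/
def Constr.coeff (S : Problem n P) (β : Behavior P) : Constr P → Fin n → ℝ
  | .state p => S.C p
  | .upper => β.gain S
  | .lower => -β.gain S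

/-- The constant term of a constraint, written as `γᵀ x + δ ≤ 0` in the state by means of the
control law of the arc. -/
def Constr.const (S : Problem n P) (β : Behavior P) : Constr P → ℝ
  | .state p => S.d p
  | .upper => β.bias S - S.um
  | .lower => -β.bias S - S.um

/-- The `r`-th time derivative, at the state `x` and along the dynamics of `β`, of the constraint
function `γᵀ x + δ`: for `r ≥ 1` it is `γᵀ Â ^ (r - 1) (Â x + b̂)`. -/
def Constr.jet (S : Problem n P) (β : Behavior P) (q : Constr P) (x : Fin n → ℝ) : ℕ → ℝ
  | 0 => q.coeff S β ⬝ᵥ x + q.const S β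
  | r + 1 => q.coeff S β ⬝ᵥ ((β.mat S ^ r) *ᵥ (β.mat S *ᵥ x + β.vec S))

/-- How an arc meets the boundary of a constraint at one of its end points: with the first
nonvanishing derivative of order `k` (`k = 0` means that the constraint is inactive there), or with
all derivatives zero, so that the constraint is identically active on the arc. -/
inductive Contact where
  | finite (k : ℕ)
  | identical

/-- The contact condition at the left end point of an arc (feasibility to the right of it). -/
def Contact.AtStart (S : Problem n P) (β : Behavior P) (q : Constr P) (x : Fin n → ℝ) :
    Contact → Prop
  | .finite k => (∀ r < k, q.jet S β x r = 0) ∧ q.jet S β x k < 0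
  | .identical => ∀ r ≤ n, q.jet S β x r = 0

/-- The contact condition at the right end point of an arc (feasibility to the left of it). -/
def Contact.AtEnd (S : Problem n P) (β : Behavior P) (q : Constr P) (x : Fin n → ℝ) :
    Contact → Prop
  | .finite k => (∀ r < k, q.jet S β x r = 0) ∧ (-1) ^ k * q.jet S β x k < 0
  | .identical => ∀ r ≤ n, q.jet S β x r = 0

/-- A tangent marker: a nonempty set of constraints (those with `ord q ≠ none`) to whose boundaries
the trajectory is tangent inside an arc, each with its even positive order. -/
structure TangentMarker (P : ℕ) where
  ord : Constr P → Option ℕ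
  nonempty : ∃ q, ord q ≠ none
  even_pos : ∀ q k, ord q = some k → Even k ∧ 0 < k

/-- The tangent condition for a marker at the state `x`. -/
def TangentMarker.Holds (S : Problem n P) (β : Behavior P) (T : TangentMarker P)
    (x : Fin n → ℝ) : Prop :=
  ∀ q k, T.ord q = some k → (∀ r < k, q.jet S β x r = 0) ∧ q.jet S β x k < 0

/-- What happens at an interior keypoint: a tangent marker inside an arc, or the connection of two
arcs with the contact of the preceding arc (`before`) and of the following arc (`after`) with each
constraint.  This comprises the connection conditions for the constraints active on one of
the two arcs and the additional end-constraint for all other constraints. -/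
inductive Keypoint (P : ℕ) where
  | tangent (T : TangentMarker P)
  | connection (before after : Constr P → Contact)

/-- The equalities and strict inequalities prescribed at an interior keypoint between pieces with
behaviors `β₁` and `β₂`. -/
def Keypoint.Holds (S : Problem n P) (β₁ β₂ : Behavior P) (x : Fin n → ℝ) :
    Keypoint P → Prop
  | .tangent T => T.Holds S β₁ x
  | .connection before after =>
      ∀ q, (before q).AtEnd S β₁ q x ∧ (after q).AtStart S β₂ q x

/-- An augmented switching law, listed keypoint by keypoint: the `K` interior keypoints cut the
trajectory into `K + 1` pieces, the piece `i` follows `behavior i`, and the keypoint `j` lies between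
the pieces `j.castSucc` and `j.succ`.  A maximal run of pieces joined by tangent markers is an arc.
No motion times are part of the law. -/
structure AugmentedSwitchingLaw (P K : ℕ) where
  behavior : Fin (K + 1) → Behavior P
  keypoint : Fin K → Keypoint P
  tangent_same : ∀ j T, keypoint j = .tangent T → behavior j.castSucc = behavior j.succ

/-- The trajectory `(x, u)` from `x0` to `xf` is represented by the law `L` with keypoint times
`0 = t 0 < t 1 < ⋯ < t (K + 1) = tf`: on each piece it follows the dynamics, the control law and the
equality constraints of the behavior, and at each interior keypoint it satisfies the equalities and
strict inequalities of the law.  (At a keypoint the control takes one of its one-sided values.)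
Feasibility is not required here. -/
structure Represents (S : Problem n P) (L : AugmentedSwitchingLaw P K) (x : ℝ → Fin n → ℝ)
    (u : ℝ → ℝ) (t : Fin (K + 2) → ℝ) : Prop where
  time_zero : t 0 = 0
  time_strictMono : StrictMono t
  initial : x 0 = S.x0
  terminal : x (t (Fin.last (K + 1))) = S.xf
  continuousOn : ContinuousOn x (Icc 0 (t (Fin.last (K + 1))))
  dynamics : ∀ i : Fin (K + 1), ∀ s ∈ Ioo (t i.castSucc) (t i.succ),
    HasDerivAt x ((L.behavior i).mat S *ᵥ x s + (L.behavior i).vec S) s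
  control : ∀ s ∈ Icc 0 (t (Fin.last (K + 1))), ∃ i : Fin (K + 1),
    s ∈ Icc (t i.castSucc) (t i.succ) ∧ u s = (L.behavior i).control S (x s)
  equalities : ∀ i : Fin (K + 1), ∀ s ∈ Icc (t i.castSucc) (t i.succ),
    (L.behavior i).Equalities S (x s)
  keypoints : ∀ j : Fin K,
    (L.keypoint j).Holds S (L.behavior j.castSucc) (L.behavior j.succ) (x (t j.succ.castSucc))

/-- The constraint `q` is identically active on the piece `i`. -/
def IdenticallyActive (S : Problem n P) (L : AugmentedSwitchingLaw P K) (x : ℝ → Fin n → ℝ)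
    (t : Fin (K + 2) → ℝ) (i : Fin (K + 1)) (q : Constr P) : Prop :=
  ∀ s ∈ Ioo (t i.castSucc) (t i.succ), q.jet S (L.behavior i) (x s) 0 = 0

/-- `(x, u)` is a feasible bang-bang and singular trajectory with finitely many arcs (hence without
chattering), `L` is its augmented switching law, and `t` lists all its keypoints. -/
structure IsASL (S : Problem n P) (L : AugmentedSwitchingLaw P K) (x : ℝ → Fin n → ℝ)
    (u : ℝ → ℝ) (t : Fin (K + 2) → ℝ) : Prop where
  feasible : Feasible S x u (t (Fin.last (K + 1)))
  represents : Represents S L x u t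
  /-- the active set of each behavior contains all state constraints active along the arc -/
  active_full : ∀ i p, IdenticallyActive S L x t i (.state p) → p ∈ (L.behavior i).active
  /-- no boundary is touched in isolation strictly between two consecutive keypoints -/
  inactive_between : ∀ i q, ¬ IdenticallyActive S L x t i q →
    ∀ s ∈ Ioo (t i.castSucc) (t i.succ), q.jet S (L.behavior i) (x s) 0 < 0
  /-- a tangent marker contains all constraints that are touched in isolation at its time -/
  marker_full : ∀ j T, L.keypoint j = .tangent T → ∀ q, T.ord q = none →
    ¬ IdenticallyActive S L x t j.succ q →
    q.jet S (L.behavior j.succ) (x (t j.succ.castSucc)) 0 < 0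
  /-- consecutive arcs are different -/
  connection_ne : ∀ j before after, L.keypoint j = .connection before after →
    L.behavior j.castSucc ≠ L.behavior j.succ

end BBS

end

/-!
In homogeneous coordinates `z = (x, 1)` the dynamics along an arc are linear, `z' = L z`, each
constraint is a linear functional `ℓ z`, and its time derivatives are `ℓ (L ^ r z)`. The states of a
represented trajectory at the keypoints are therefore obtained by composing the flows `exp (τ L)`
from the fixed initial state, and depend continuously on the keypoint times
(`exists_continuous_keypoint_state`).

Consider one piece between consecutive keypoints and one constraint.

* If the constraint is identically active on the reference piece, then all its derivatives vanish at
  the start of the corresponding piece of every represented trajectory. At a connection the law says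
  so for the derivatives up to order `n`, and Cayley–Hamilton gives the others; at time `0` the
  states agree; and through a tangent marker the property is carried by the flow
  (`Represents.jet_eq_zero_of_identicallyActive_of_represents`).

* Otherwise it is negative inside the reference piece, and at each end its first nonzero derivative
  has a fixed order and the strict sign that points into the feasible side. Every represented
  trajectory has the same vanishing derivatives at the ends (`IsASL.exists_order_at_start`,
  `IsASL.exists_order_at_end`): by the law at interior keypoints, and because the end points are
  fixed at the first and the last time. Near an end, Taylor's formula and the persisting sign of the
  first nonzero derivative make the constraint nonpositive; away from the ends it stays negative by
  continuity. Compactness of the piece makes this uniform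
  (`eventually_output_nonpos_on_interval`).

There are finitely many pieces and constraints, so a single neighbourhood of the keypoint times
works. The state equation in integral form follows from the fundamental theorem of calculus, since
the trajectory is continuous and satisfies the differential equation off the finite set of keypoint
times (`Represents.feasible`).
-/

namespace BBS

open Filter Topology

/-! ### Outputs of linear flows -/

section LinearFlow

variable {E : Type*} [NormedAddCommGroup E] [NormedSpace ℝ E]

/-- The flow `exp (τ L)` of the linear differential equation `z' = L z`. -/
noncomputable def expFlow (L : E →L[ℝ] E) (τ : ℝ) : E →L[ℝ] E :=
  NormedSpace.exp (τ • L)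

@[simp] lemma expFlow_zero (L : E →L[ℝ] E) (z : E) : expFlow L 0 z = z := by
  simp [expFlow]

lemma expFlow_neg (L : E →L[ℝ] E) (τ : ℝ) : expFlow (-L) τ = expFlow L (-τ) := by
  simp [expFlow]

lemma commute_expFlow (L : E →L[ℝ] E) (τ : ℝ) : Commute L (expFlow L τ) :=
  ((Commute.refl L).smul_right τ).exp_right

/-- By Cayley–Hamilton, finitely many vanishing derivatives make an output vanish to all orders. -/
lemma jet_eq_zero_of_lt_finrank [FiniteDimensional ℝ E] (L : E →L[ℝ] E) (ℓ : E →L[ℝ] ℝ) {z : E}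
    (h : ∀ r < Module.finrank ℝ E, ℓ ((L ^ r) z) = 0) (m : ℕ) : ℓ ((L ^ m) z) = 0 := by
  have hcoe : ∀ k : ℕ, (L ^ k) z = ((L : E →ₗ[ℝ] E) ^ k) z := fun k => by
    rw [← ContinuousLinearMap.toLinearMap_pow]; rfl
  rw [hcoe, LinearMap.pow_eq_aeval_mod_charpoly, Polynomial.aeval_eq_sum_range]
  simp only [LinearMap.sum_apply, LinearMap.smul_apply, map_sum, map_smul]
  refine Finset.sum_eq_zero fun k hk => ?_
  by_cases hk' : k < Module.finrank ℝ E
  · rw [← hcoe, h k hk', smul_zero]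
  · rw [Polynomial.coeff_eq_zero_of_degree_lt, zero_smul]
    refine (Polynomial.degree_modByMonic_lt _ (LinearMap.charpoly_monic _)).trans_le ?_
    rw [Polynomial.degree_eq_natDegree (LinearMap.charpoly_monic _).ne_zero,
      LinearMap.charpoly_natDegree]
    exact_mod_cast not_lt.1 hk'

lemma neg_pow_apply_output (L : E →L[ℝ] E) (ℓ : E →L[ℝ] ℝ) (r : ℕ) (z : E) :
    ℓ (((-L) ^ r) z) = (-1) ^ r * ℓ ((L ^ r) z) := by
  rcases Nat.even_or_odd r with hr | hr
  · simp [hr.neg_pow]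
  · simp [hr.neg_pow]

variable [CompleteSpace E]

lemma expFlow_add (L : E →L[ℝ] E) (σ τ : ℝ) (z : E) :
    expFlow L (σ + τ) z = expFlow L σ (expFlow L τ z) := by
  have hc : Commute (σ • L) (τ • L) := (Commute.refl L).smul_left σ |>.smul_right τ
  have := NormedSpace.exp_add_of_commute_of_mem_ball (𝕂 := ℝ) hc
    (by simp [NormedSpace.expSeries_radius_eq_top])
    (by simp [NormedSpace.expSeries_radius_eq_top])
  simp only [expFlow, add_smul, this]
  rfl

lemma hasDerivAt_expFlow (L : E →L[ℝ] E) (τ : ℝ) :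
    HasDerivAt (expFlow L) (L * expFlow L τ) τ :=
  hasDerivAt_exp_smul_const' L τ

lemma continuous_expFlow_apply (L : E →L[ℝ] E) :
    Continuous fun p : ℝ × E => expFlow L p.1 p.2 := by
  have h : Continuous (expFlow L) :=
    continuous_iff_continuousAt.2 fun τ => (hasDerivAt_expFlow L τ).continuousAt
  exact (h.comp continuous_fst).clm_apply continuous_snd

lemma hasDerivAt_output (L : E →L[ℝ] E) (ℓ : E →L[ℝ] ℝ) (z : E) (r : ℕ) (τ : ℝ) :
    HasDerivAt (fun σ => ℓ ((L ^ r) (expFlow L σ z))) (ℓ ((L ^ (r + 1)) (expFlow L τ z))) τ := by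
  have h := (hasDerivAt_expFlow L τ).clm_apply (hasDerivAt_const τ z)
  have h2 := (ℓ.comp (L ^ r)).hasFDerivAt.comp_hasDerivAt τ h
  simp only [map_zero, add_zero] at h2
  rw [pow_succ]
  exact h2

/-- The output of a linear flow is the sum of its Taylor series. -/
lemma hasSum_output (L : E →L[ℝ] E) (ℓ : E →L[ℝ] ℝ) (z : E) (τ : ℝ) :
    HasSum (fun r : ℕ => (r.factorial : ℝ)⁻¹ * (τ ^ r * ℓ ((L ^ r) z))) (ℓ (expFlow L τ z)) := by
  have h := NormedSpace.exp_series_hasSum_exp' (𝕂 := ℝ) (τ • L)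
  have h2 := h.mapL (ℓ.comp (ContinuousLinearMap.apply ℝ E z))
  simpa [expFlow, smul_pow] using h2

lemma output_eq_zero_of_jet_eq_zero (L : E →L[ℝ] E) (ℓ : E →L[ℝ] ℝ) {z : E}
    (h : ∀ r, ℓ ((L ^ r) z) = 0) (τ : ℝ) (r : ℕ) : ℓ ((L ^ r) (expFlow L τ z)) = 0 := by
  have h1 := hasSum_output L (ℓ.comp (L ^ r)) z τ
  have h2 : ∀ m, ℓ ((L ^ r) ((L ^ m) z)) = 0 := fun m => by
    rw [← mul_apply_eq_comp, ← pow_add]; exact h _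
  simp only [ContinuousLinearMap.comp_apply, h2, mul_zero] at h1
  exact h1.unique hasSum_zero

/-- An output that vanishes on an open interval has zero derivatives of all orders at every time. -/
lemma jet_eq_zero_of_output_eq_zero (L : E →L[ℝ] E) (ℓ : E →L[ℝ] ℝ) {z : E} {T : ℝ} (hT : 0 < T)
    (h : ∀ τ ∈ Ioo 0 T, ℓ (expFlow L τ z) = 0) (τ : ℝ) (r : ℕ) :
    ℓ ((L ^ r) (expFlow L τ z)) = 0 := by
  have key : ∀ r, ∀ τ ∈ Ioo 0 T, ℓ ((L ^ r) (expFlow L τ z)) = 0 := by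
    intro r
    induction r with
    | zero => simpa using h
    | succ r ih =>
      intro τ hτ
      have h1 : (fun σ => ℓ ((L ^ r) (expFlow L σ z))) =ᶠ[𝓝 τ] fun _ => 0 := by
        filter_upwards [isOpen_Ioo.mem_nhds hτ] with σ hσ using ih σ hσ
      exact (hasDerivAt_output L ℓ z r τ).unique
        ((hasDerivAt_const τ (0 : ℝ)).congr_of_eventuallyEq h1)
  have h3 := output_eq_zero_of_jet_eq_zero L ℓ (z := expFlow L (T / 2) z)
    (fun r => key r _ ⟨by linarith, by linarith⟩) (τ - T / 2) r
  rwa [← expFlow_add, sub_add_cancel] at h3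

/-- Taylor's formula for signs: a function whose first nonzero derivative at `0` is of order `k`
and stays negative is nonpositive to the right of `0`. -/
lemma nonpos_of_iterated_deriv_neg {h : ℕ → ℝ → ℝ} (k : ℕ)
    (hd : ∀ r s, HasDerivAt (h r) (h (r + 1) s) s) (h0 : ∀ r < k, h r 0 = 0) {c : ℝ}
    (hk : ∀ s ∈ Icc 0 c, h k s < 0) : ∀ s ∈ Icc 0 c, h 0 s ≤ 0 := by
  induction k generalizing h with
  | zero => exact fun s hs => (hk s hs).le
  | succ k ih =>
    have h1 : ∀ s ∈ Icc 0 c, h 1 s ≤ 0 :=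
      ih (h := fun r => h (r + 1)) (fun r s => hd _ s) (fun r hr => h0 _ (by omega)) hk
    intro s hs
    have hanti : AntitoneOn (h 0) (Icc 0 c) :=
      antitoneOn_of_hasDerivWithinAt_nonpos (convex_Icc 0 c)
        (fun y _ => (hd 0 y).continuousAt.continuousWithinAt)
        (fun y _ => (hd 0 y).hasDerivWithinAt)
        (fun y hy => h1 y (interior_subset hy))
    have := hanti ⟨le_rfl, hs.1.trans hs.2⟩ hs hs.1
    rwa [h0 0 (by omega)] at this

/-- If the derivative of order `k` of an output is negative at `z₀`, then it gives nonpositive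
outputs for short positive times from all nearby points whose lower derivatives vanish. -/
lemma eventually_output_nonpos (L : E →L[ℝ] E) (ℓ : E →L[ℝ] ℝ) {z₀ : E} {k : ℕ}
    (hk : ℓ ((L ^ k) z₀) < 0) :
    ∀ᶠ p : ℝ × E in 𝓝 (0, z₀), 0 ≤ p.1 → (∀ r < k, ℓ ((L ^ r) p.2) = 0) →
      ℓ (expFlow L p.1 p.2) ≤ 0 := by
  have hc : Continuous fun p : ℝ × E => ℓ ((L ^ k) (expFlow L p.1 p.2)) :=
    ℓ.continuous.comp ((L ^ k).continuous.comp (continuous_expFlow_apply L))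
  have hev := hc.continuousAt.eventually_lt (x₀ := ((0 : ℝ), z₀)) (g := fun _ => (0 : ℝ))
    continuousAt_const (by simpa using hk)
  obtain ⟨δ, hδ, hball⟩ := Metric.eventually_nhds_iff.1 hev
  refine Metric.eventually_nhds_iff.2 ⟨δ, hδ, ?_⟩
  rintro ⟨s, z⟩ hp hs hz
  refine nonpos_of_iterated_deriv_neg (h := fun r σ => ℓ ((L ^ r) (expFlow L σ z))) k
    (fun r σ => hasDerivAt_output L ℓ z r σ) (by simpa using hz) (c := s) ?_ s ⟨hs, le_rfl⟩
  intro σ hσ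
  refine hball (y := (σ, z)) (lt_of_le_of_lt ?_ hp)
  simp only [Prod.dist_eq, Real.dist_eq, sub_zero, abs_of_nonneg hσ.1, abs_of_nonneg hs]
  exact max_le_max hσ.2 le_rfl

/-- An output that is negative for small positive times vanishes at time `0` to some finite order,
and its first nonzero derivative there is negative. -/
lemma exists_first_jet_neg (L : E →L[ℝ] E) (ℓ : E →L[ℝ] ℝ) {z : E} {T : ℝ} (hT : 0 < T)
    (h : ∀ τ ∈ Ioo 0 T, ℓ (expFlow L τ z) < 0) :
    ∃ k, (∀ r < k, ℓ ((L ^ r) z) = 0) ∧ ℓ ((L ^ k) z) < 0 := by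
  classical
  have hex : ∃ k, ℓ ((L ^ k) z) ≠ 0 := by
    by_contra! hall
    have h1 := output_eq_zero_of_jet_eq_zero L ℓ hall (T / 2) 0
    have h2 := h (T / 2) ⟨by linarith, by linarith⟩
    simp only [pow_zero, one_apply_eq_self] at h1
    linarith
  have hmin : ∀ r < Nat.find hex, ℓ ((L ^ r) z) = 0 := fun r hr => not_not.1 (Nat.find_min hex hr)
  refine ⟨Nat.find hex, hmin, ?_⟩
  refine lt_of_le_of_ne (not_lt.1 fun hpos => ?_) (Nat.find_spec hex)
  -- a positive first derivative would make the output nonnegative for small positive times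
  have hev := eventually_output_nonpos L (-ℓ) (z₀ := z) (k := Nat.find hex) (by simpa using hpos)
  have hev' : ∀ᶠ s : ℝ in 𝓝 0, 0 ≤ s → 0 ≤ ℓ (expFlow L s z) := by
    have ht : Tendsto (fun s : ℝ => (s, z)) (𝓝 0) (𝓝 (0, z)) := Continuous.tendsto (by fun_prop) 0
    filter_upwards [ht.eventually hev] with s hs h0
    simpa using hs h0 (by simpa using hmin)
  obtain ⟨s, hs, hs'⟩ := ((hev'.filter_mono nhdsWithin_le_nhds).and
    (Ioo_mem_nhdsGT hT)).exists
  exact absurd (hs hs'.1.le) (not_le.2 (h s hs'))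

/-- The analogue of `exists_first_jet_neg` at the end of a time interval, with the alternating sign
of time reversal. -/
lemma exists_last_jet_neg (L : E →L[ℝ] E) (ℓ : E →L[ℝ] ℝ) {z : E} {T : ℝ} (hT : 0 < T)
    (h : ∀ τ ∈ Ioo 0 T, ℓ (expFlow L τ z) < 0) :
    ∃ k, (∀ r < k, ℓ ((L ^ r) (expFlow L T z)) = 0) ∧
      (-1) ^ k * ℓ ((L ^ k) (expFlow L T z)) < 0 := by
  obtain ⟨k, h1, h2⟩ := exists_first_jet_neg (-L) ℓ (z := expFlow L T z) hT (by
    intro τ hτ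
    rw [expFlow_neg, ← expFlow_add]
    exact h _ ⟨by linarith [hτ.2], by linarith [hτ.1]⟩)
  refine ⟨k, fun r hr => ?_, by rwa [neg_pow_apply_output] at h2⟩
  have h3 := h1 r hr
  rw [neg_pow_apply_output] at h3
  exact (mul_eq_zero.1 h3).resolve_left (pow_ne_zero _ (by norm_num))

/-- Stability of a sign under perturbation: let the output along `z₀` be negative inside `[0, T₀]`,
with first nonzero derivatives of orders `k₁` and `k₂` at the ends. Then the output is nonpositive
for all nearby initial points and durations that keep the vanishing derivatives at the ends. -/
lemma eventually_output_nonpos_on_interval (L : E →L[ℝ] E) (ℓ : E →L[ℝ] ℝ) {z₀ : E} {T₀ : ℝ}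
    (hT₀ : 0 < T₀) {k₁ k₂ : ℕ} (h₁ : ℓ ((L ^ k₁) z₀) < 0)
    (h₂ : (-1) ^ k₂ * ℓ ((L ^ k₂) (expFlow L T₀ z₀)) < 0)
    (h : ∀ τ ∈ Ioo 0 T₀, ℓ (expFlow L τ z₀) < 0) :
    ∀ᶠ p : E × ℝ in 𝓝 (z₀, T₀), (∀ r < k₁, ℓ ((L ^ r) p.1) = 0) →
      (∀ r < k₂, ℓ ((L ^ r) (expFlow L p.2 p.1)) = 0) →
      ∀ τ ∈ Icc 0 p.2, ℓ (expFlow L τ p.1) ≤ 0 := by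
  have key : ∀ᶠ p : E × ℝ in 𝓝 (z₀, T₀), ∀ τ ∈ Icc 0 (T₀ + 1),
      (∀ r < k₁, ℓ ((L ^ r) p.1) = 0) →
      (∀ r < k₂, ℓ ((L ^ r) (expFlow L p.2 p.1)) = 0) → 0 ≤ τ → τ ≤ p.2 →
      ℓ (expFlow L τ p.1) ≤ 0 := by
    refine isCompact_Icc.eventually_forall_of_forall_eventually fun τ₀ hτ₀ => ?_
    rcases hτ₀.1.eq_or_lt with h0 | h0
    · subst h0
      have ht : Tendsto (fun w : (E × ℝ) × ℝ => (w.2, w.1.1)) (𝓝 ((z₀, T₀), 0)) (𝓝 (0, z₀)) :=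
        Continuous.tendsto (by fun_prop) _
      filter_upwards [ht.eventually (eventually_output_nonpos L ℓ h₁)] with w hw hl _ h0 _
        using hw h0 hl
    rcases lt_trichotomy τ₀ T₀ with hlt | heq | hgt
    · have hc : Continuous fun w : (E × ℝ) × ℝ => ℓ (expFlow L w.2 w.1.1) :=
        ℓ.continuous.comp ((continuous_expFlow_apply L).comp
          (continuous_snd.prodMk (continuous_fst.comp continuous_fst)))
      have hev := hc.continuousAt.eventually_lt (x₀ := ((z₀, T₀), τ₀)) (g := fun _ => (0 : ℝ))
        continuousAt_const (h τ₀ ⟨h0, hlt⟩)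
      filter_upwards [hev] with w hw _ _ _ _ using hw.le
    · subst heq
      -- near the right end, run time backwards from the end point
      have hc : Continuous fun w : (E × ℝ) × ℝ => (w.1.2 - w.2, expFlow L w.1.2 w.1.1) :=
        (by fun_prop : Continuous fun w : (E × ℝ) × ℝ => w.1.2 - w.2).prodMk
          ((continuous_expFlow_apply L).comp (by fun_prop : Continuous fun w : (E × ℝ) × ℝ =>
            (w.1.2, w.1.1)))
      have ht := hc.tendsto ((z₀, τ₀), τ₀)
      simp only [sub_self] at ht
      have hev := eventually_output_nonpos (-L) ℓ (z₀ := expFlow L τ₀ z₀) (k := k₂)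
        (by rwa [neg_pow_apply_output])
      filter_upwards [ht.eventually hev] with w hw _ hr _ hle
      have := hw (by linarith) (fun r hr' => by
        rw [neg_pow_apply_output, hr r hr', mul_zero])
      rwa [expFlow_neg, ← expFlow_add, neg_sub, sub_add_cancel] at this
    · have hev : ∀ᶠ w : (E × ℝ) × ℝ in 𝓝 ((z₀, T₀), τ₀), w.1.2 < w.2 :=
        (by fun_prop : Continuous fun w : (E × ℝ) × ℝ => w.1.2).continuousAt.eventually_lt
          continuous_snd.continuousAt hgt
      filter_upwards [hev] with w hw _ _ _ hle using absurd hle (not_le.2 hw)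
  have hT : ∀ᶠ p : E × ℝ in 𝓝 (z₀, T₀), p.2 < T₀ + 1 :=
    continuous_snd.continuousAt.eventually_lt continuousAt_const (by simp)
  filter_upwards [key, hT] with p hp hpT hl hr τ hτ
  exact hp τ ⟨hτ.1, hτ.2.trans hpT.le⟩ hl hr hτ.1 hτ.2

/-- A solution of `z' = L z` inside an interval that is continuous up to its ends is given by the
flow. -/
lemma eq_expFlow_of_hasDerivAt (L : E →L[ℝ] E) {z : ℝ → E} {a c : ℝ}
    (hc : ContinuousOn z (Icc a c)) (hd : ∀ s ∈ Ioo a c, HasDerivAt z (L (z s)) s) :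
    ∀ s ∈ Icc a c, z s = expFlow L (s - a) (z a) := by
  intro s hs
  -- the pulled-back curve `exp (-(σ - a) L) z σ` is constant
  set w : ℝ → E := fun σ => expFlow L (a - σ) (z σ) with hw
  have hwc : ContinuousOn w (Icc a s) :=
    (continuous_expFlow_apply L).comp_continuousOn
      ((continuousOn_const.sub continuousOn_id).prodMk (hc.mono (Icc_subset_Icc_right hs.2)))
  have hwd : ∀ σ ∈ Ioo a s, HasDerivAt w 0 σ := by
    intro σ hσ
    have h1 : HasDerivAt (fun σ => expFlow L (a - σ)) (-(L * expFlow L (a - σ))) σ := by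
      have h0 := (hasDerivAt_expFlow L (a - σ)).scomp σ ((hasDerivAt_id σ).const_sub a)
      rw [neg_one_smul] at h0
      exact h0
    have h2 := h1.clm_apply (hd σ ⟨hσ.1, hσ.2.trans_le hs.2⟩)
    have h3 : (L * expFlow L (a - σ)) (z σ) = expFlow L (a - σ) (L (z σ)) := by
      rw [(commute_expFlow L (a - σ)).eq]; rfl
    convert h2 using 1
    rw [_root_.neg_apply, h3, neg_add_cancel]
  have hint := intervalIntegral.integral_eq_sub_of_hasDerivAt_of_le hs.1 hwc hwd
    (intervalIntegrable_const (c := (0 : E)))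
  rw [intervalIntegral.integral_zero] at hint
  have hws : w s = z a := by
    rw [sub_eq_zero.1 hint.symm]; simp [hw]
  rw [← hws, hw, ← expFlow_add]
  simp

end LinearFlow

/-! ### Arcs and constraints in homogeneous coordinates -/

section Augmented

variable {n P K : ℕ}

/-- The generator of the dynamics along an arc in homogeneous coordinates: `x' = Â x + b̂` becomes
the linear equation `z' = L z` for `z = (x, 1)`. -/
noncomputable def Behavior.gen (S : Problem n P) (β : Behavior P) :
    ((Fin n → ℝ) × ℝ) →L[ℝ] ((Fin n → ℝ) × ℝ) :=
  ((LinearMap.toContinuousLinearMap (β.mat S).mulVecLin).comp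
      (ContinuousLinearMap.fst ℝ (Fin n → ℝ) ℝ) +
    (ContinuousLinearMap.snd ℝ (Fin n → ℝ) ℝ).smulRight (β.vec S)).prod 0

/-- The constraint function `γᵀ x + δ` as a linear functional of `z = (x, 1)`. -/
noncomputable def Constr.out (S : Problem n P) (β : Behavior P) (q : Constr P) :
    ((Fin n → ℝ) × ℝ) →L[ℝ] ℝ :=
  (LinearMap.toContinuousLinearMap (dotProductBilin ℝ ℝ (q.coeff S β))).comp
      (ContinuousLinearMap.fst ℝ (Fin n → ℝ) ℝ) +
    q.const S β • ContinuousLinearMap.snd ℝ (Fin n → ℝ) ℝ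

lemma Behavior.gen_apply (S : Problem n P) (β : Behavior P) (z : (Fin n → ℝ) × ℝ) :
    β.gen S z = (β.mat S *ᵥ z.1 + z.2 • β.vec S, 0) := rfl

lemma Constr.out_apply (S : Problem n P) (β : Behavior P) (q : Constr P)
    (z : (Fin n → ℝ) × ℝ) : q.out S β z = q.coeff S β ⬝ᵥ z.1 + q.const S β * z.2 := rfl

lemma Behavior.gen_pow_succ_apply (S : Problem n P) (β : Behavior P) (y : Fin n → ℝ) (r : ℕ) :
    (β.gen S ^ (r + 1)) (y, 1) = (β.mat S ^ r *ᵥ (β.mat S *ᵥ y + β.vec S), 0) := by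
  induction r with
  | zero => simp [Behavior.gen_apply]
  | succ r ih =>
    rw [pow_succ', mul_apply_eq_comp, ih, Behavior.gen_apply, pow_succ' (β.mat S),
      ← mulVec_mulVec]
    simp

lemma Constr.jet_eq_out (S : Problem n P) (β : Behavior P) (q : Constr P) (y : Fin n → ℝ) (r : ℕ) :
    q.jet S β y r = q.out S β ((β.gen S ^ r) (y, 1)) := by
  cases r with
  | zero => simp [Constr.jet, Constr.out_apply]
  | succ r => rw [Behavior.gen_pow_succ_apply]; simp [Constr.jet, Constr.out_apply]

/-- The arc condition `Contact.identical` involves the derivatives up to order `n` only, which is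
enough as `(x, 1)` lives in dimension `n + 1`. -/
lemma Constr.jet_eq_zero_of_le (S : Problem n P) (β : Behavior P) (q : Constr P) {y : Fin n → ℝ}
    (h : ∀ r ≤ n, q.jet S β y r = 0) (r : ℕ) : q.jet S β y r = 0 := by
  rw [Constr.jet_eq_out]
  refine jet_eq_zero_of_lt_finrank _ _ (fun m hm => ?_) r
  rw [← Constr.jet_eq_out]
  exact h m (by simp at hm; omega)

end Augmented

/-! ### Constraints along trajectories with the same law -/

section Represented

variable {n P K : ℕ} {S : Problem n P} {L : AugmentedSwitchingLaw P K}
  {x x' : ℝ → Fin n → ℝ} {u u' : ℝ → ℝ} {t t' : Fin (K + 2) → ℝ}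

lemma Represents.lt_succ (h : Represents S L x u t) (i : Fin (K + 1)) :
    t i.castSucc < t i.succ :=
  h.time_strictMono Fin.castSucc_lt_succ

lemma Represents.piece_subset (h : Represents S L x u t) (i : Fin (K + 1)) :
    Icc (t i.castSucc) (t i.succ) ⊆ Icc 0 (t (Fin.last (K + 1))) := by
  rw [← h.time_zero]
  exact Icc_subset_Icc (h.time_strictMono.monotone (Fin.zero_le _))
    (h.time_strictMono.monotone (Fin.le_last _))

/-- On each piece a represented trajectory is given by the flow of the behavior. -/
lemma Represents.eq_expFlow (h : Represents S L x u t) (i : Fin (K + 1)) {s : ℝ}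
    (hs : s ∈ Icc (t i.castSucc) (t i.succ)) :
    (x s, (1 : ℝ)) =
      expFlow ((L.behavior i).gen S) (s - t i.castSucc) (x (t i.castSucc), 1) := by
  refine eq_expFlow_of_hasDerivAt (z := fun s => (x s, (1 : ℝ))) _
    ((h.continuousOn.mono (h.piece_subset i)).prodMk continuousOn_const) (fun σ hσ => ?_) s hs
  rw [Behavior.gen_apply]
  simpa using (h.dynamics i σ hσ).prodMk (hasDerivAt_const σ (1 : ℝ))

lemma Represents.eq_expFlow_succ (h : Represents S L x u t) (i : Fin (K + 1)) :
    (x (t i.succ), (1 : ℝ)) =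
      expFlow ((L.behavior i).gen S) (t i.succ - t i.castSucc) (x (t i.castSucc), 1) :=
  h.eq_expFlow i ⟨(h.lt_succ i).le, le_rfl⟩

/-- The constraint function along a piece is an output of the flow of that piece. -/
lemma Represents.jet_eq_output (h : Represents S L x u t) (i : Fin (K + 1)) (q : Constr P) {τ : ℝ}
    (hτ : τ ∈ Icc 0 (t i.succ - t i.castSucc)) :
    q.jet S (L.behavior i) (x (t i.castSucc + τ)) 0 =
      q.out S (L.behavior i) (expFlow ((L.behavior i).gen S) τ (x (t i.castSucc), 1)) := by
  rw [Constr.jet_eq_out, h.eq_expFlow i ⟨by linarith [hτ.1], by linarith [hτ.2]⟩]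
  simp

/-- The states at the keypoints are continuous functions of the keypoint times. -/
lemma exists_continuous_keypoint_state (S : Problem n P) (L : AugmentedSwitchingLaw P K)
    (i : Fin (K + 2)) :
    ∃ Z : (Fin (K + 2) → ℝ) → (Fin n → ℝ) × ℝ, Continuous Z ∧
      ∀ x u t, Represents S L x u t → (x (t i), (1 : ℝ)) = Z t := by
  induction i using Fin.induction with
  | zero =>
    exact ⟨fun _ => (S.x0, 1), continuous_const, fun x u t h => by rw [h.time_zero, h.initial]⟩
  | succ i ih =>
    obtain ⟨Z, hZ, hrep⟩ := ih
    refine ⟨fun t => expFlow ((L.behavior i).gen S) (t i.succ - t i.castSucc) (Z t),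
      (continuous_expFlow_apply _).comp
        ((by fun_prop : Continuous fun t : Fin (K + 2) → ℝ => t i.succ - t i.castSucc).prodMk hZ),
      fun x u t h => ?_⟩
    simp only [← hrep x u t h, h.eq_expFlow_succ]

lemma Represents.initial_eq (h : Represents S L x u t) (h' : Represents S L x' u' t') :
    x' (t' 0) = x (t 0) := by
  rw [h.time_zero, h'.time_zero, h.initial, h'.initial]

lemma Represents.jet_eq_zero_of_identicallyActive (h : Represents S L x u t) {i : Fin (K + 1)}
    {q : Constr P} (hq : IdenticallyActive S L x t i q) {s : ℝ}
    (hs : s ∈ Icc (t i.castSucc) (t i.succ)) (r : ℕ) :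
    q.jet S (L.behavior i) (x s) r = 0 := by
  rw [Constr.jet_eq_out, h.eq_expFlow i hs]
  refine jet_eq_zero_of_output_eq_zero _ _ (sub_pos.2 (h.lt_succ i)) (fun τ hτ => ?_) _ r
  rw [← h.jet_eq_output i q ⟨hτ.1.le, hτ.2.le⟩]
  exact hq _ ⟨by linarith [hτ.1], by linarith [hτ.2]⟩

lemma Represents.jet_eq_zero_of_jet_eq_zero (h : Represents S L x u t) {i : Fin (K + 1)}
    {q : Constr P} {s σ : ℝ} (hs : s ∈ Icc (t i.castSucc) (t i.succ))
    (hσ : σ ∈ Icc (t i.castSucc) (t i.succ))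
    (hq : ∀ r, q.jet S (L.behavior i) (x s) r = 0) (r : ℕ) :
    q.jet S (L.behavior i) (x σ) r = 0 := by
  simp only [Constr.jet_eq_out] at hq ⊢
  have h1 := output_eq_zero_of_jet_eq_zero _ _ hq (σ - s) r
  rw [h.eq_expFlow i hs, ← expFlow_add] at h1
  rw [h.eq_expFlow i hσ]
  simpa using h1

/-- A constraint that is identically active on a piece has zero derivatives of all orders at the
start of that piece for every trajectory with the same law: this propagates through tangent
markers, and at a connection it is prescribed by the law. -/
lemma Represents.jet_eq_zero_of_identicallyActive_of_represents (h : Represents S L x u t)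
    (h' : Represents S L x' u' t') (q : Constr P) (i : Fin (K + 1))
    (hq : IdenticallyActive S L x t i q) (r : ℕ) :
    q.jet S (L.behavior i) (x' (t' i.castSucc)) r = 0 := by
  have hleft : ∀ i : Fin (K + 1), IdenticallyActive S L x t i q →
      ∀ r, q.jet S (L.behavior i) (x (t i.castSucc)) r = 0 := fun i hq =>
    h.jet_eq_zero_of_identicallyActive hq ⟨le_rfl, (h.lt_succ i).le⟩
  induction i using Fin.induction generalizing r with
  | zero =>
    have h0 := hleft 0 hq r
    rw [Fin.castSucc_zero] at h0 ⊢
    rwa [h.initial_eq h']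
  | succ j ih =>
    have hk := h.keypoints j
    have hk' := h'.keypoints j
    have hx := hleft j.succ hq
    have ht := h.lt_succ j.castSucc
    have ht' := h'.lt_succ j.castSucc
    cases hkp : L.keypoint j with
    | tangent T =>
      have hβ := L.tangent_same j T hkp
      rw [← hβ] at hx ⊢
      rw [Fin.succ_castSucc] at ht ht'
      refine h'.jet_eq_zero_of_jet_eq_zero (i := j.castSucc) (s := t' j.castSucc.castSucc)
        ⟨le_rfl, (h'.lt_succ _).le⟩ ?_ (fun r => ih (fun s hs => ?_) r) r
      · rw [Fin.succ_castSucc]; exact ⟨ht'.le, le_rfl⟩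
      · exact h.jet_eq_zero_of_jet_eq_zero (i := j.castSucc) (s := t j.succ.castSucc)
          (by rw [Fin.succ_castSucc]; exact ⟨ht.le, le_rfl⟩) (Ioo_subset_Icc_self hs) hx 0
    | connection before after =>
      rw [hkp] at hk hk'
      have h1 := (hk q).2
      have h2 := (hk' q).2
      cases ha : after q with
      | finite k =>
        -- excluded for the reference trajectory by identical activity on the following arc
        rw [ha] at h1
        exact absurd (hx k) h1.2.ne
      | identical =>
        rw [ha] at h2
        exact Constr.jet_eq_zero_of_le S _ q h2 r

/-- The order of contact at the start of a piece, for a constraint that is not identically active,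
is common to all trajectories with the same law. -/
lemma IsASL.exists_order_at_start (h : IsASL S L x u t) (i : Fin (K + 1)) (q : Constr P)
    (hq : ¬ IdenticallyActive S L x t i q) :
    ∃ k, q.jet S (L.behavior i) (x (t i.castSucc)) k < 0 ∧
      ∀ x' u' t', Represents S L x' u' t' →
        ∀ r < k, q.jet S (L.behavior i) (x' (t' i.castSucc)) r = 0 := by
  have hrep := h.represents
  cases i using Fin.cases with
  | zero =>
    -- the law prescribes nothing at time `0`, but all trajectories start from the same state
    obtain ⟨k, h1, h2⟩ := exists_first_jet_neg ((L.behavior 0).gen S) (q.out S (L.behavior 0))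
      (z := (x (t 0), 1)) (sub_pos.2 (hrep.lt_succ 0)) (fun τ hτ => by
        have := hrep.jet_eq_output 0 q ⟨hτ.1.le, hτ.2.le⟩
        rw [Fin.castSucc_zero] at this hτ
        rw [← this]
        exact h.inactive_between 0 q hq _ ⟨by simpa using hτ.1, by linarith [hτ.2]⟩)
    refine ⟨k, by rwa [Constr.jet_eq_out, Fin.castSucc_zero], fun x' u' t' h' r hr => ?_⟩
    rw [Constr.jet_eq_out, Fin.castSucc_zero, hrep.initial_eq h']
    exact h1 r hr
  | succ j =>
    have hk := hrep.keypoints j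
    cases hkp : L.keypoint j with
    | tangent T =>
      have hβ := L.tangent_same j T hkp
      rw [hkp] at hk
      cases hT : T.ord q with
      | none =>
        -- an unmarked constraint is inactive at the marker, so the order is `0`
        exact ⟨0, h.marker_full j T hkp q hT hq, fun _ _ _ _ r hr => absurd hr (by simp)⟩
      | some k =>
        refine ⟨k, hβ ▸ (hk q k hT).2, fun x' u' t' h' r hr => ?_⟩
        have hk' := h'.keypoints j
        rw [hkp] at hk'
        exact hβ ▸ (hk' q k hT).1 r hr
    | connection before after =>
      rw [hkp] at hk
      have h1 := (hk q).2
      cases ha : after q with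
      | finite k =>
        rw [ha] at h1
        refine ⟨k, h1.2, fun x' u' t' h' r hr => ?_⟩
        have hk' := h'.keypoints j
        rw [hkp] at hk'
        have h2 := (hk' q).2
        rw [ha] at h2
        exact h2.1 r hr
      | identical =>
        rw [ha] at h1
        -- the constraint would be identically active on the following arc
        exact absurd (fun s hs => hrep.jet_eq_zero_of_jet_eq_zero
          ⟨le_rfl, (hrep.lt_succ j.succ).le⟩ (Ioo_subset_Icc_self hs)
          (Constr.jet_eq_zero_of_le S _ q h1) 0) hq

/-- The order of contact at the end of a piece, for a constraint that is not identically active,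
is common to all trajectories with the same law. -/
lemma IsASL.exists_order_at_end (h : IsASL S L x u t) (i : Fin (K + 1)) (q : Constr P)
    (hq : ¬ IdenticallyActive S L x t i q) :
    ∃ k, (-1) ^ k * q.jet S (L.behavior i) (x (t i.succ)) k < 0 ∧
      ∀ x' u' t', Represents S L x' u' t' →
        ∀ r < k, q.jet S (L.behavior i) (x' (t' i.succ)) r = 0 := by
  have hrep := h.represents
  cases i using Fin.lastCases with
  | last =>
    -- the law prescribes nothing at the final time, but all trajectories end in the same state
    obtain ⟨k, h1, h2⟩ := exists_last_jet_neg ((L.behavior (Fin.last K)).gen S)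
      (q.out S (L.behavior (Fin.last K)))
      (z := (x (t (Fin.last K).castSucc), 1)) (sub_pos.2 (hrep.lt_succ (Fin.last K)))
      (fun τ hτ => by
        rw [← hrep.jet_eq_output (Fin.last K) q ⟨hτ.1.le, hτ.2.le⟩]
        exact h.inactive_between _ q hq _ ⟨by linarith [hτ.1], by linarith [hτ.2]⟩)
    simp only [← hrep.eq_expFlow_succ] at h1 h2
    refine ⟨k, by rwa [Constr.jet_eq_out], fun x' u' t' h' r hr => ?_⟩
    have h3 := h1 r hr
    rw [Fin.succ_last, hrep.terminal] at h3
    rw [Constr.jet_eq_out, Fin.succ_last, h'.terminal]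
    exact h3
  | cast j =>
    have hk := hrep.keypoints j
    cases hkp : L.keypoint j with
    | tangent T =>
      have hβ := L.tangent_same j T hkp
      rw [hkp] at hk
      cases hT : T.ord q with
      | none =>
        -- the marker lies inside one arc, so activity on one side of it is activity on both
        have hq' : ¬ IdenticallyActive S L x t j.succ q := fun hact => hq fun s hs => by
          have h0 := hrep.jet_eq_zero_of_identicallyActive hact
            ⟨le_rfl, (hrep.lt_succ j.succ).le⟩
          rw [← hβ] at h0
          exact hrep.jet_eq_zero_of_jet_eq_zero (s := t j.castSucc.succ)
            ⟨(hrep.lt_succ _).le, le_rfl⟩ (Ioo_subset_Icc_self hs) h0 0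
        have h1 := h.marker_full j T hkp q hT hq'
        rw [← hβ] at h1
        exact ⟨0, by simpa using h1, fun _ _ _ _ r hr => absurd hr (by simp)⟩
      | some k =>
        refine ⟨k, by simpa [(T.even_pos q k hT).1.neg_one_pow] using (hk q k hT).2,
          fun x' u' t' h' r hr => ?_⟩
        have hk' := h'.keypoints j
        rw [hkp] at hk'
        exact (hk' q k hT).1 r hr
    | connection before after =>
      rw [hkp] at hk
      have h1 := (hk q).1
      cases ha : before q with
      | finite k =>
        rw [ha] at h1
        refine ⟨k, h1.2, fun x' u' t' h' r hr => ?_⟩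
        have hk' := h'.keypoints j
        rw [hkp] at hk'
        have h2 := (hk' q).1
        rw [ha] at h2
        exact h2.1 r hr
      | identical =>
        rw [ha] at h1
        -- the constraint would be identically active on the preceding arc
        exact absurd (fun s hs => hrep.jet_eq_zero_of_jet_eq_zero (s := t j.castSucc.succ)
          ⟨(hrep.lt_succ j.castSucc).le, le_rfl⟩ (Ioo_subset_Icc_self hs)
          (Constr.jet_eq_zero_of_le S _ q h1) 0) hq

/-- On each piece, each constraint holds for all trajectories with the same law and nearby keypoint
times. -/
lemma IsASL.eventually_constraint (h : IsASL S L x u t) (i : Fin (K + 1)) (q : Constr P) :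
    ∀ᶠ t' in 𝓝 t, ∀ x' u', Represents S L x' u' t' →
      ∀ s ∈ Icc (t' i.castSucc) (t' i.succ), q.jet S (L.behavior i) (x' s) 0 ≤ 0 := by
  have hrep := h.represents
  by_cases hq : IdenticallyActive S L x t i q
  · refine Eventually.of_forall fun t' x' u' h' s hs => ?_
    exact (h'.jet_eq_zero_of_jet_eq_zero ⟨le_rfl, (h'.lt_succ i).le⟩ hs
      (hrep.jet_eq_zero_of_identicallyActive_of_represents h' q i hq) 0).le
  obtain ⟨k₁, hk₁, hz₁⟩ := h.exists_order_at_start i q hq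
  obtain ⟨k₂, hk₂, hz₂⟩ := h.exists_order_at_end i q hq
  obtain ⟨Z, hZ, hZrep⟩ := exists_continuous_keypoint_state S L i.castSucc
  have hev := eventually_output_nonpos_on_interval ((L.behavior i).gen S)
    (q.out S (L.behavior i)) (z₀ := (x (t i.castSucc), 1)) (sub_pos.2 (hrep.lt_succ i))
    (k₁ := k₁) (k₂ := k₂) (by rwa [← Constr.jet_eq_out])
    (by rwa [← hrep.eq_expFlow_succ, ← Constr.jet_eq_out])
    (fun τ hτ => by
      rw [← hrep.jet_eq_output i q ⟨hτ.1.le, hτ.2.le⟩]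
      exact h.inactive_between i q hq _ ⟨by linarith [hτ.1], by linarith [hτ.2]⟩)
  rw [hZrep x u t hrep] at hev
  have hc : Continuous fun t' : Fin (K + 2) → ℝ => (Z t', t' i.succ - t' i.castSucc) :=
    hZ.prodMk (by fun_prop)
  filter_upwards [(hc.tendsto t).eventually hev] with t' ht' x' u' h' s hs
  rw [← hZrep x' u' t' h'] at ht'
  have h1 := ht' (fun r hr => by rw [← Constr.jet_eq_out]; exact hz₁ x' u' t' h' r hr)
    (fun r hr => by
      rw [← h'.eq_expFlow_succ, ← Constr.jet_eq_out]; exact hz₂ x' u' t' h' r hr)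
    (s - t' i.castSucc) ⟨by linarith [hs.1], by linarith [hs.2]⟩
  rwa [← h'.jet_eq_output i q ⟨by linarith [hs.1], by linarith [hs.2]⟩,
    add_sub_cancel] at h1

end Represented

/-! ### Feasibility from the constraints on the pieces -/

section Feasibility

variable {n P K : ℕ} {S : Problem n P} {L : AugmentedSwitchingLaw P K}
  {x : ℝ → Fin n → ℝ} {u : ℝ → ℝ} {t : Fin (K + 2) → ℝ}

lemma Behavior.mat_mulVec_add_vec (S : Problem n P) (β : Behavior P) (y : Fin n → ℝ) :
    β.mat S *ᵥ y + β.vec S = S.A *ᵥ y + β.control S y • S.b := by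
  cases β with
  | unconstrained s => simp [Behavior.mat, Behavior.vec, Behavior.control, Behavior.gain]
  | constrained Q hQ =>
    simp [Behavior.mat, Behavior.vec, Behavior.control, Behavior.gain, Behavior.bias,
      Problem.closedLoop, add_mulVec, vecMulVec_mulVec]

/-- Inside a piece the control is the one of that piece. -/
lemma Represents.control_eq (h : Represents S L x u t) {i : Fin (K + 1)} {s : ℝ}
    (hs : s ∈ Ioo (t i.castSucc) (t i.succ)) : u s = (L.behavior i).control S (x s) := by
  obtain ⟨j, hj, hu⟩ := h.control s (h.piece_subset i (Ioo_subset_Icc_self hs))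
  have hmono := h.time_strictMono.monotone
  rcases lt_trichotomy i j with hij | hij | hij
  · have : t i.succ ≤ t j.castSucc := hmono (by simpa [Fin.le_iff_val_le_val] using hij)
    linarith [hj.1, hs.2]
  · rw [hij, hu]
  · have : t j.succ ≤ t i.castSucc := hmono (by simpa [Fin.le_iff_val_le_val] using hij)
    linarith [hj.2, hs.1]

lemma Represents.control_integrableOn (h : Represents S L x u t) :
    IntegrableOn u (Icc 0 (t (Fin.last (K + 1)))) := by
  have hpiece : ∀ i : Fin (K + 1), IntegrableOn u (Icc (t i.castSucc) (t i.succ)) := by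
    intro i
    have hc : ContinuousOn (fun s => (L.behavior i).control S (x s))
        (Icc (t i.castSucc) (t i.succ)) := by
      have hx := h.continuousOn.mono (h.piece_subset i)
      have : Continuous ((L.behavior i).control S) := by
        unfold Behavior.control dotProduct; fun_prop
      exact this.comp_continuousOn hx
    have hi := hc.integrableOn_compact (μ := volume) isCompact_Icc
    rw [integrableOn_Icc_iff_integrableOn_Ioo] at hi ⊢
    exact hi.congr_fun (fun s hs => (h.control_eq hs).symm) measurableSet_Ioo
  refine (integrableOn_finite_iUnion.2 hpiece).mono_set fun s hs => ?_
  obtain ⟨i, hi, -⟩ := h.control s hs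
  exact mem_iUnion.2 ⟨i, hi⟩

/-- A represented trajectory that satisfies the inequality constraints piece by piece is
feasible. -/
lemma Represents.feasible (h : Represents S L x u t)
    (hq : ∀ i (q : Constr P), ∀ s ∈ Icc (t i.castSucc) (t i.succ),
      q.jet S (L.behavior i) (x s) 0 ≤ 0) :
    Feasible S x u (t (Fin.last (K + 1))) := by
  have h0 : 0 ≤ t (Fin.last (K + 1)) := by
    rw [← h.time_zero]; exact h.time_strictMono.monotone (Fin.zero_le _)
  have hint : IntervalIntegrable u volume 0 (t (Fin.last (K + 1))) :=
    (intervalIntegrable_iff_integrableOn_Icc_of_le h0).2 h.control_integrableOn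
  refine ⟨h0, h.continuousOn, hint, fun s hs => ?_, h.initial, h.terminal, fun s hs p => ?_,
    fun s hs => ?_⟩
  · have hsub : Icc 0 s ⊆ Icc 0 (t (Fin.last (K + 1))) := Icc_subset_Icc_right hs.2
    have hA : ContinuousOn (fun σ => S.A *ᵥ x σ) (Icc 0 s) :=
      (S.A.mulVecLin.continuous_of_finiteDimensional).comp_continuousOn (h.continuousOn.mono hsub)
    have hu : IntervalIntegrable u volume 0 s :=
      (intervalIntegrable_iff_integrableOn_Icc_of_le hs.1).2 (h.control_integrableOn.mono_set hsub)
    -- the state equation may fail at the finitely many keypoint times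
    have := integral_eq_of_hasDerivAt_off_countable (a := 0) (b := s) x
      (fun σ => S.A *ᵥ x σ + u σ • S.b) (s := range t) (countable_range t)
      (by rw [uIcc_of_le hs.1]; exact h.continuousOn.mono hsub)
      (fun σ hσ => by
        rw [min_eq_left hs.1, max_eq_right hs.1] at hσ
        obtain ⟨i, hi, hui⟩ := h.control σ (hsub (Ioo_subset_Icc_self hσ.1))
        rw [hui, ← Behavior.mat_mulVec_add_vec]
        exact h.dynamics i σ ⟨hi.1.lt_of_ne fun e => hσ.2 ⟨_, e⟩,
          hi.2.lt_of_ne fun e => hσ.2 ⟨_, e.symm⟩⟩)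
      ((ContinuousOn.intervalIntegrable_of_Icc hs.1 hA).add
        ⟨hu.1.smul_const S.b, hu.2.smul_const S.b⟩)
    rw [this]; abel
  · obtain ⟨i, hi, -⟩ := h.control s hs
    exact hq i (.state p) s hi
  · obtain ⟨i, hi, hui⟩ := h.control s hs
    have h1 := hq i .upper s hi
    have h2 := hq i .lower s hi
    simp only [Constr.jet, Constr.coeff, Constr.const, neg_dotProduct] at h1 h2
    rw [hui, abs_le, Behavior.control]
    constructor <;> linarith

lemma eventually_forall_constr {X : Type*} {f : Filter X} {p : Constr P → X → Prop}
    (h : ∀ q, ∀ᶠ y in f, p q y) : ∀ᶠ y in f, ∀ q, p q y := by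
  filter_upwards [eventually_all.2 fun i => h (.state i), h .upper, h .lower] with y h1 h2 h3 q
  cases q
  exacts [h1 _, h2, h3]

end Feasibility

end BBS

theorem theorem2 {n P K : ℕ} (S : BBS.Problem n P) (L : BBS.AugmentedSwitchingLaw P K)
    (x : ℝ → Fin n → ℝ) (u : ℝ → ℝ) (t : Fin (K + 2) → ℝ)
    (hx : BBS.IsASL S L x u t) :
    ∃ ε : ℝ, 0 < ε ∧
      ∀ (x' : ℝ → Fin n → ℝ) (u' : ℝ → ℝ) (t' : Fin (K + 2) → ℝ),
        BBS.Represents S L x' u' t' → ‖t' - t‖ < ε →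
          BBS.Feasible S x' u' (t' (Fin.last (K + 1))) := by
  have hev := Filter.eventually_all.2 fun i =>
    BBS.eventually_forall_constr fun q => hx.eventually_constraint i q
  obtain ⟨ε, hε, hball⟩ := Metric.eventually_nhds_iff.1 hev
  refine ⟨ε, hε, fun x' u' t' h' ht' => h'.feasible fun i q => ?_⟩
  exact hball (by rwa [dist_eq_norm]) i q x' u' h'
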